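/- For a finite simple graph $\Gamma$ with vertex set $v(\Gamma)$ and edge set $e(\Gamma)$, let $M_1(\Gamma)=\sum_{v\in v(\Gamma)}\deg(v)^2$ and $M_2(\Gamma)=\sum_{uv\in e(\Gamma)}\deg(u)\deg(v)$. If $\Gamma$ has at least one edge, it is said to satisfy the Hansen–Vukičević inequality if $$\frac{M_2(\Gamma)}{|e(\Gamma)|}\ \ge\ \frac{M_1(\Gamma)}{|v(\Gamma)|}.$$ For a finite group $G$, the commuting conjugacy class graph $\mathcal{CCC}(G)$ is the simple graph whose vertices are the conjugacy classes of the non-central elements of $G$, two distinct classes $x^G,y^G$ being adjacent if and only if there are $x'\in x^G$ and $y'\in y^G$ with $x'y'=y'x'$. A finite group $Q$ is a Frobenius group if it has a subgroup $1\ne H\ne Q$ with $H\cap gHg^{-1}=1$ for all $g\in Q\setminus H$. **Theorem.** Let $p$ and $q$ be primes and let $G$ be a finite group with centre $Z(G)$ such that $G/Z(G)$ is a Frobenius group of order $p^2q$. Suppose that $G/Z(G)\cong A_4$, or that $p<q$ and $|G/Z(G)|\neq 12$, or that $p>q$. Then $\mathcal{CCC}(G)$ has at least one edge and satisfies the Hansen–Vukičević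 inequality. Moreover, the inequality is strict if and only if $q\neq p^4-p^2+1$; in particular it is strict whenever $G/Z(G)\cong A_4$ or $p>q$. -/

import Mathlib

/-- The first Zagreb index `M₁(Γ) = ∑ deg(v)²`, the sum over all vertices. -/
def SimpleGraph.firstZagreb {V : Type*} [Fintype V] (Γ : SimpleGraph V)
    [DecidableRel Γ.Adj] : ℕ :=
  ∑ v : V, Γ.degree v ^ 2

/-- The second Zagreb index `M₂(Γ) = ∑ deg(u) deg(v)`, the sum over all (unordered) edges `uv`. -/
def SimpleGraph.secondZagreb {V : Type*} [Fintype V] (Γ : SimpleGraph V)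
    [DecidableRel Γ.Adj] : ℕ :=
  ∑ e ∈ Γ.edgeFinset,
    Sym2.lift ⟨fun u v => Γ.degree u * Γ.degree v, fun _ _ => Nat.mul_comm _ _⟩ e

/-- The ratio `M₁(Γ) / |v(Γ)|` (meaningful for a nonempty vertex set). -/
def SimpleGraph.firstZagrebRatio {V : Type*} [Fintype V] (Γ : SimpleGraph V)
    [DecidableRel Γ.Adj] : ℚ :=
  (Γ.firstZagreb : ℚ) / (Fintype.card V : ℚ)

/-- The ratio `M₂(Γ) / |e(Γ)|` (meaningful for a nonempty edge set). -/
def SimpleGraph.secondZagrebRatio {V : Type*} [Fintype V] (Γ : SimpleGraph V)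
    [DecidableRel Γ.Adj] : ℚ :=
  (Γ.secondZagreb : ℚ) / (Γ.edgeFinset.card : ℚ)

/-- The Hansen–Vukičević inequality `M₂(Γ)/|e(Γ)| ≥ M₁(Γ)/|v(Γ)|`; the graph is required to have
an edge (hence also a vertex), so that both ratios make sense. -/
def SimpleGraph.SatisfiesHansenVukicevic {V : Type*} [Fintype V] (Γ : SimpleGraph V)
    [DecidableRel Γ.Adj] : Prop :=
  Γ.edgeFinset.Nonempty ∧ Γ.secondZagrebRatio ≥ Γ.firstZagrebRatio

/-- The vertices of the commuting conjugacy class graph: the conjugacy classes of the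
non-central elements of `G`. -/
def CCCVertex (G : Type*) [Group G] : Type _ :=
  {c : ConjClasses G // ∃ g : G, g ∉ Subgroup.center G ∧ ConjClasses.mk g = c}

/-- The commuting conjugacy class graph: two distinct classes of non-central elements are adjacent
iff they have commuting representatives. -/
def CCCGraph (G : Type*) [Group G] : SimpleGraph (CCCVertex G) where
  Adj c d := c ≠ d ∧ ∃ x y : G, ConjClasses.mk x = c.1 ∧ ConjClasses.mk y = d.1 ∧ x * y = y * x
  symm := ⟨fun _ _ h => ⟨h.1.symm, by
    obtain ⟨-, x, y, hx, hy, hxy⟩ := h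
    exact ⟨y, x, hy, hx, hxy.symm⟩⟩⟩
  loopless := ⟨fun _ h => h.1 rfl⟩

instance (G : Type*) [Group G] [Finite G] : Finite (CCCVertex G) := by
  unfold CCCVertex
  have : Finite (ConjClasses G) := Quotient.finite _
  infer_instance

noncomputable instance (G : Type*) [Group G] [Finite G] : Fintype (CCCVertex G) :=
  Fintype.ofFinite _

noncomputable instance (G : Type*) [Group G] : DecidableRel (CCCGraph G).Adj :=
  Classical.decRel _

/-- A Frobenius group: it has a nontrivial proper subgroup `H` (a Frobenius complement) with
`H ∩ gHg⁻¹ = 1` for every `g ∉ H`. Used for finite groups. -/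
def IsFrobeniusGroup (Q : Type*) [Group Q] : Prop :=
  ∃ H : Subgroup Q, H ≠ ⊥ ∧ H ≠ ⊤ ∧
    ∀ g : Q, g ∉ H → H ⊓ H.map (MulAut.conj g).toMonoidHom = ⊥

/-! Let `H` be a Frobenius complement and `K` the kernel of `G/Z(G)`, and put z = |Z(G)|; then {|H|,
|K|} = {p², q}. All centralizers of non-central elements of `G` are abelian, so the graph is a
disjoint union of complete graphs. Adjacent vertices then have equal degree, 2M₂ is the sum of the
cubes of the degrees, and the inequality is Chebyshev's sum inequality, strict exactly when the
graph is not regular.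

Every vertex has a representative lying over `H` or over `K`. Counting how often a class meets a
centralizer shows that degree + 1 is (|H| - 1)z over `H`, and (|K| - 1)z/|H| over `K` when the
preimage of `K` is abelian. If |K| = q, the two values agree iff p²(p² - 1) = q - 1, which is the
exceptional equation. If |K| = p², agreement would need q(q - 1) = p² - 1, impossible for q < p and
for (p, q) = (2, 3). If the preimage of `K` is not abelian, degree + 1 is at most (p - 1)z/p over
`K`, less than the value (q - 1)z over `H`. Here q divides p² - 1, so the exceptional equation fails
as well. -/

namespace SimpleGraph

/-! ### Zagreb indices and Chebyshev's inequality -/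

variable {V : Type*} [Fintype V] (Γ : SimpleGraph V) [DecidableRel Γ.Adj]

theorem two_mul_sum_edgeFinset (f : Sym2 V → ℕ) :
    2 * ∑ e ∈ Γ.edgeFinset, f e = ∑ d : Γ.Dart, f d.edge := by
  classical
  rw [← Finset.sum_fiberwise_of_maps_to (s := Finset.univ) (t := Γ.edgeFinset)
    (g := fun d : Γ.Dart => d.edge)
    (fun d _ => by rw [mem_edgeFinset]; exact d.edge_mem), Finset.mul_sum]
  refine Finset.sum_congr rfl fun e he => ?_
  rw [Finset.sum_congr rfl (g := fun _ => f e)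
    (fun d hd => by rw [(Finset.mem_filter.mp hd).2]), Finset.sum_const,
    Γ.dart_edge_fiber_card e (mem_edgeFinset.mp he), smul_eq_mul]

theorem sum_dart_fst (g : V → ℕ) : ∑ d : Γ.Dart, g d.fst = ∑ v, Γ.degree v * g v := by
  classical
  rw [← Finset.sum_fiberwise_of_maps_to (s := Finset.univ) (t := Finset.univ)
    (g := fun d : Γ.Dart => d.fst) (fun d _ => Finset.mem_univ _)]
  refine Finset.sum_congr rfl fun v _ => ?_
  rw [Finset.sum_congr rfl (g := fun _ => g v)
    (fun d hd => by rw [(Finset.mem_filter.mp hd).2]), Finset.sum_const,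
    smul_eq_mul]
  congr 1
  convert Γ.dart_fst_fiber_card_eq_degree v

variable {Γ}

/-- Each edge carries two darts, and on each of them the product of the end degrees is the square of
the degree at the initial vertex. -/
theorem two_mul_secondZagreb (h : ∀ u v, Γ.Adj u v → Γ.degree u = Γ.degree v) :
    2 * Γ.secondZagreb = ∑ v, Γ.degree v ^ 3 := by
  rw [secondZagreb, two_mul_sum_edgeFinset]
  calc _ = ∑ d : Γ.Dart, Γ.degree d.fst ^ 2 := by
        refine Finset.sum_congr rfl fun d _ => ?_
        change Γ.degree d.fst * Γ.degree d.snd = _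
        rw [← h _ _ d.adj, sq]
    _ = _ := by
        rw [Γ.sum_dart_fst (fun v => Γ.degree v ^ 2)]
        exact Finset.sum_congr rfl fun v _ => by ring

end SimpleGraph

/-- The identity behind Chebyshev's inequality; its right side vanishes, for nonnegative `d`, only
if `d` is constant. -/
theorem two_mul_card_mul_sum_cube_sub {V : Type*} [Fintype V] (d : V → ℚ) :
    2 * (Fintype.card V * ∑ v, d v ^ 3 - (∑ v, d v ^ 2) * ∑ v, d v) =
      ∑ u, ∑ v, (d u - d v) ^ 2 * (d u + d v) := by
  have h : ∀ u v, (d u - d v) ^ 2 * (d u + d v) =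
      d u ^ 3 + d v ^ 3 - d u ^ 2 * d v - d u * d v ^ 2 := fun u v => by ring
  simp only [h, Finset.sum_add_distrib, Finset.sum_sub_distrib, Finset.sum_const,
    Finset.card_univ, nsmul_eq_mul, ← Finset.mul_sum, ← Finset.sum_mul]
  ring

namespace SimpleGraph

variable {V : Type*} [Fintype V] {Γ : SimpleGraph V} [DecidableRel Γ.Adj]

/-- In a graph whose adjacent vertices have equal degrees the Hansen–Vukičević inequality is
Chebyshev's sum inequality for the degree sequence. -/
theorem satisfiesHansenVukicevic_of_adj_degree_eq
    (h : ∀ u v, Γ.Adj u v → Γ.degree u = Γ.degree v) (hpos : ∃ v, 0 < Γ.degree v) :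
    Γ.SatisfiesHansenVukicevic ∧
      (Γ.secondZagrebRatio > Γ.firstZagrebRatio ↔ ∃ u v, Γ.degree u ≠ Γ.degree v) := by
  obtain ⟨w, hw⟩ := hpos
  have hedge : Γ.edgeFinset.Nonempty := by
    obtain ⟨x, hx⟩ := (Γ.degree_pos_iff_exists_adj w).mp hw
    exact ⟨s(w, x), mem_edgeFinset.mpr hx⟩
  have hn : (0 : ℚ) < Fintype.card V := by exact_mod_cast Fintype.card_pos_iff.mpr ⟨w⟩
  have he : (0 : ℚ) < Γ.edgeFinset.card := by exact_mod_cast hedge.card_pos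
  have h2 : (2 : ℚ) * Γ.secondZagreb = ∑ v, (Γ.degree v : ℚ) ^ 3 := by
    exact_mod_cast two_mul_secondZagreb h
  have h1 : (Γ.firstZagreb : ℚ) = ∑ v, (Γ.degree v : ℚ) ^ 2 := by
    rw [firstZagreb]; push_cast; rfl
  have h0 : (2 : ℚ) * Γ.edgeFinset.card = ∑ v, (Γ.degree v : ℚ) := by
    exact_mod_cast Γ.sum_degrees_eq_twice_card_edges.symm
  have key := two_mul_card_mul_sum_cube_sub (fun v => (Γ.degree v : ℚ))
  simp only [← h0, ← h1, ← h2] at key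
  have hnn : ∀ u v : V, 0 ≤ ((Γ.degree u : ℚ) - Γ.degree v) ^ 2 * (Γ.degree u + Γ.degree v) :=
    fun u v => by positivity
  refine ⟨⟨hedge, ?_⟩, ?_⟩
  · have : 0 ≤ ∑ u, ∑ v, ((Γ.degree u : ℚ) - Γ.degree v) ^ 2 * (Γ.degree u + Γ.degree v) :=
      Finset.sum_nonneg fun u _ => Finset.sum_nonneg fun v _ => hnn u v
    rw [secondZagrebRatio, firstZagrebRatio, ge_iff_le, div_le_div_iff₀ hn he]
    linarith
  · have hiff : Γ.secondZagrebRatio > Γ.firstZagrebRatio ↔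
        0 < ∑ u, ∑ v, ((Γ.degree u : ℚ) - Γ.degree v) ^ 2 * (Γ.degree u + Γ.degree v) := by
      rw [secondZagrebRatio, firstZagrebRatio, gt_iff_lt, div_lt_div_iff₀ hn he, ← key]
      constructor <;> intro _ <;> linarith
    rw [hiff]
    constructor
    · intro hlt
      by_contra! hall
      refine hlt.ne' (Finset.sum_eq_zero fun u _ => Finset.sum_eq_zero fun v _ => ?_)
      rw [hall u v]; ring
    · rintro ⟨u, v, huv⟩
      refine Finset.sum_pos' (fun u _ => Finset.sum_nonneg fun v _ => hnn u v)
        ⟨u, Finset.mem_univ _, Finset.sum_pos' (fun v _ => hnn u v) ⟨v, Finset.mem_univ _, ?_⟩⟩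
      have hsub : (Γ.degree u : ℚ) - Γ.degree v ≠ 0 := sub_ne_zero.mpr (by exact_mod_cast huv)
      have hsum : (0 : ℚ) < Γ.degree u + Γ.degree v := by
        have : 0 < Γ.degree u + Γ.degree v := by omega
        exact_mod_cast this
      positivity

/-- If adjacency is transitive on distinct vertices then adjacent vertices have equal degrees. -/
theorem degree_eq_of_adj_of_trans
    (h : ∀ u v w, Γ.Adj u v → Γ.Adj v w → u ≠ w → Γ.Adj u w) {u v : V} (huv : Γ.Adj u v) :
    Γ.degree u = Γ.degree v := by
  classical
  -- Adjacent vertices have the same closed neighbourhood.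
  have hle : ∀ {u v : V}, Γ.Adj u v →
      insert u (Γ.neighborFinset u) ⊆ insert v (Γ.neighborFinset v) := by
    intro u v huv w hw
    simp only [Finset.mem_insert, mem_neighborFinset] at hw ⊢
    rcases hw with rfl | hw
    · exact .inr huv.symm
    · by_cases hwv : w = v
      · exact .inl hwv
      · exact .inr (h v u w huv.symm hw (Ne.symm hwv))
  have := congrArg Finset.card ((hle huv).antisymm (hle huv.symm))
  rw [Finset.card_insert_of_notMem (by simp), Finset.card_insert_of_notMem (by simp)] at this
  simpa using this

end SimpleGraph

/-! ### Frobenius complements and kernels of coprime order -/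

section Frobenius

variable {Q : Type*} [Group Q]

/-- `H` is a Frobenius complement and `K` the Frobenius kernel of a Frobenius group. -/
structure IsFrobeniusPair (H K : Subgroup Q) : Prop where
  normal : K.Normal
  mem_or_conj_mem : ∀ x, x ∈ K ∨ ∃ g, g * x * g⁻¹ ∈ H
  mem_of_conj_mem : ∀ h ∈ H, h ≠ 1 → ∀ g, g * h * g⁻¹ ∈ H → g ∈ H
  mem_of_commute : ∀ k ∈ K, k ≠ 1 → ∀ g, Commute k g → g ∈ K
  disjoint : Disjoint H K

theorem IsFrobeniusPair.mem_of_commute_left {H K : Subgroup Q} (h : IsFrobeniusPair H K) {x g : Q}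
    (hx : x ∈ H) (hx1 : x ≠ 1) (hg : Commute x g) : g ∈ H :=
  h.mem_of_conj_mem x hx hx1 g (by rwa [← hg.eq, mul_inv_cancel_right])

theorem mem_of_conj_mem_of_inf_map_conj_eq_bot {H : Subgroup Q}
    (hH : ∀ g : Q, g ∉ H → H ⊓ H.map (MulAut.conj g).toMonoidHom = ⊥)
    {h : Q} (hh : h ∈ H) (h1 : h ≠ 1) {g : Q} (hg : g * h * g⁻¹ ∈ H) : g ∈ H := by
  by_contra hgH
  have hmem : g * h * g⁻¹ ∈ H ⊓ H.map (MulAut.conj g).toMonoidHom :=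
    ⟨hg, h, hh, by simp⟩
  rw [hH g hgH, Subgroup.mem_bot] at hmem
  exact h1 (by simpa using hmem)

variable {H K : Subgroup Q}

theorem eq_one_of_conj_mem_of_coprime (hc : (Nat.card H).Coprime (Nat.card K)) {x g : Q}
    (hx : x ∈ H) (hk : g * x * g⁻¹ ∈ K) : x = 1 := by
  rw [← orderOf_eq_one_iff]
  refine Nat.eq_one_of_dvd_coprimes hc (Subgroup.orderOf_dvd_natCard H hx) ?_
  have := Subgroup.orderOf_dvd_natCard K hk
  rwa [← MulAut.conj_apply, MulEquiv.orderOf_eq] at this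

variable [Finite Q]

/-- The conjugates of `H` meet trivially, so their nontrivial elements number |K|(|H| - 1). By
coprimality of orders none lies in `K`, so together with `K` they exhaust `Q`. This replaces
Frobenius's theorem on the kernel. -/
theorem mem_or_conj_mem_of_coprime
    (hH : ∀ h ∈ H, h ≠ 1 → ∀ g, g * h * g⁻¹ ∈ H → g ∈ H)
    (hc : (Nat.card H).Coprime (Nat.card K)) (hHK : Nat.card H * Nat.card K = Nat.card Q) (x : Q) :
    x ∈ K ∨ ∃ g, ∃ h ∈ H, h ≠ 1 ∧ g * h * g⁻¹ = x := by
  let f : ((Q ⧸ H) × {h : H // h ≠ 1}) ⊕ K → Q :=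
    Sum.elim (fun y => y.1.out * (y.2.1 : Q) * y.1.out⁻¹) (fun k => (k : Q))
  have hinj : Function.Injective f := by
    rintro (⟨a, ⟨⟨b, hb⟩, hb1⟩⟩ | ⟨k, hk⟩) (⟨a', ⟨⟨b', hb'⟩, hb1'⟩⟩ | ⟨k', hk'⟩) he
    · simp only [f, Sum.elim_inl] at he
      have hab : a'.out⁻¹ * a.out ∈ H := by
        refine hH b hb (fun h => hb1 (by simpa using h)) _ ?_
        convert! hb' using 1
        calc a'.out⁻¹ * a.out * b * (a'.out⁻¹ * a.out)⁻¹
            = a'.out⁻¹ * (a.out * b * a.out⁻¹) * a'.out := by group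
          _ = b' := by rw [he]; group
      have haa : a' = a := by
        rw [← a.out_eq', ← a'.out_eq']
        exact QuotientGroup.eq.mpr hab
      subst haa
      have : b = b' := by simpa using he
      subst this
      rfl
    · simp only [f, Sum.elim_inl, Sum.elim_inr] at he
      exact absurd (Subtype.ext (eq_one_of_conj_mem_of_coprime hc hb (he ▸ hk'))) hb1
    · simp only [f, Sum.elim_inl, Sum.elim_inr] at he
      exact absurd (Subtype.ext (eq_one_of_conj_mem_of_coprime hc hb' (he ▸ hk))) hb1'
    · simpa [f] using he
  classical
  have hcard : Nat.card Q ≤ Nat.card (((Q ⧸ H) × {h : H // h ≠ 1}) ⊕ K) := by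
    have h1 : Nat.card {h : H // h ≠ 1} + 1 = Nat.card H := by
      have := Nat.card_congr (Equiv.sumCompl (fun h : H => h = 1))
      rw [Nat.card_sum, Nat.card_unique] at this
      rw [← this, add_comm]
    have h2 : Nat.card (Q ⧸ H) = Nat.card K := by
      have := H.card_mul_index
      rw [← hHK] at this
      exact Nat.eq_of_mul_eq_mul_left Nat.card_pos this
    rw [Nat.card_sum, Nat.card_prod, h2, ← hHK, ← h1]
    exact (by ring : _ = _).le
  obtain ⟨y, rfl⟩ := (hinj.bijective_of_nat_card_le hcard).2 x
  rcases y with ⟨a, ⟨⟨b, hb⟩, hb1⟩⟩ | k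
  · exact .inr ⟨a.out, b, hb, fun h => hb1 (by simpa using h), rfl⟩
  · exact .inl k.2

/-- `K` is the complement of a conjugation-invariant set, hence normal. If a nontrivial element of
`K` commuted with one of a conjugate of `H`, it would lie in that conjugate, against coprimality. -/
theorem isFrobeniusPair_of_coprime
    (hH : ∀ h ∈ H, h ≠ 1 → ∀ g, g * h * g⁻¹ ∈ H → g ∈ H)
    (hc : (Nat.card H).Coprime (Nat.card K)) (hHK : Nat.card H * Nat.card K = Nat.card Q) :
    IsFrobeniusPair H K where
  normal := ⟨fun k hk g => by
    refine (mem_or_conj_mem_of_coprime hH hc hHK (g * k * g⁻¹)).resolve_right ?_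
    rintro ⟨a, h, hh, h1, he⟩
    refine h1 (eq_one_of_conj_mem_of_coprime hc hh (g := g⁻¹ * a) ?_)
    convert! hk using 1
    calc g⁻¹ * a * h * (g⁻¹ * a)⁻¹ = g⁻¹ * (a * h * a⁻¹) * g := by group
      _ = k := by rw [he]; group⟩
  mem_or_conj_mem x := by
    rcases mem_or_conj_mem_of_coprime hH hc hHK x with h | ⟨g, h, hh, -, rfl⟩
    · exact .inl h
    · exact .inr ⟨g⁻¹, by convert! hh using 1; group⟩
  mem_of_conj_mem := hH
  mem_of_commute k hk hk1 g hg := by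
    refine (mem_or_conj_mem_of_coprime hH hc hHK g).resolve_right ?_
    rintro ⟨a, h, hh, h1, rfl⟩
    have hcomm : a⁻¹ * k * a ∈ H := by
      refine hH h hh h1 _ ?_
      convert! hh using 1
      calc a⁻¹ * k * a * h * (a⁻¹ * k * a)⁻¹
          = a⁻¹ * (k * (a * h * a⁻¹)) * k⁻¹ * a := by group
        _ = h := by rw [hg.eq]; group
    have := eq_one_of_conj_mem_of_coprime hc (g := a) hcomm (by convert! hk using 1; group)
    refine hk1 ?_
    calc k = a * (a⁻¹ * k * a) * a⁻¹ := by group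
      _ = 1 := by rw [this]; group
  disjoint := Subgroup.disjoint_of_coprime_natCard hc

/-- A subgroup of order `r` in `H` acts on `Q ⧸ H` and fixes only the coset of `H`. -/
theorem index_modEq_one_of_prime_dvd (hH : ∀ h ∈ H, h ≠ 1 → ∀ g, g * h * g⁻¹ ∈ H → g ∈ H)
    {r : ℕ} (hr : r.Prime) (hrH : r ∣ Nat.card H) : H.index ≡ 1 [MOD r] := by
  have := Fact.mk hr
  obtain ⟨⟨x, hxH⟩, hx⟩ := exists_prime_orderOf_dvd_card' r hrH
  rw [Subgroup.orderOf_mk] at hx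
  have hP : IsPGroup r (Subgroup.zpowers x) :=
    IsPGroup.of_card (n := 1) (by rw [Nat.card_zpowers, hx, pow_one])
  have hx1 : x ≠ 1 := fun h => hr.one_lt.ne' (by rw [← hx, h, orderOf_one])
  have hfix := hP.card_modEq_card_fixedPoints (Q ⧸ H)
  suffices Nat.card (MulAction.fixedPoints (Subgroup.zpowers x) (Q ⧸ H)) = 1 by
    rwa [this] at hfix
  rw [Nat.card_eq_one_iff_unique]
  refine ⟨⟨?_⟩, ⟨⟨((1 : Q) : Q ⧸ H), ?_⟩⟩⟩
  · suffices ∀ y ∈ MulAction.fixedPoints (Subgroup.zpowers x) (Q ⧸ H), y = ((1 : Q) : Q ⧸ H) by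
      rintro ⟨a, ha⟩ ⟨b, hb⟩
      exact Subtype.ext ((this a ha).trans (this b hb).symm)
    intro y hy
    induction y using QuotientGroup.induction_on with
    | H g =>
      have h1 : ((x * g : Q) : Q ⧸ H) = (g : Q ⧸ H) := hy ⟨x, Subgroup.mem_zpowers x⟩
      rw [eq_comm, QuotientGroup.eq] at h1 ⊢
      rw [inv_one, one_mul]
      have := hH x hxH hx1 g⁻¹ (by simpa [mul_assoc] using h1)
      simpa using this
  · rintro ⟨_, n, rfl⟩
    change ((x ^ n * 1 : Q) : Q ⧸ H) = _
    rw [eq_comm, QuotientGroup.eq]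
    simpa using H.zpow_mem hxH n

theorem IsFrobeniusGroup.exists_isFrobeniusPair {p q : ℕ} (hp : p.Prime) (hq : q.Prime)
    (hQ : IsFrobeniusGroup Q) (hcard : Nat.card Q = p ^ 2 * q) :
    ∃ H K : Subgroup Q, IsFrobeniusPair H K ∧
      ((Nat.card H = p ^ 2 ∧ Nat.card K = q) ∨
        (Nat.card H = q ∧ Nat.card K = p ^ 2 ∧ q ∣ p ^ 2 - 1)) := by
  obtain ⟨H, hbot, htop, hinf⟩ := hQ
  have hH : ∀ h ∈ H, h ≠ 1 → ∀ g, g * h * g⁻¹ ∈ H → g ∈ H := fun h hh h1 g hg =>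
    mem_of_conj_mem_of_inf_map_conj_eq_bot hinf hh h1 hg
  have hm := H.card_mul_index
  rw [hcard] at hm
  -- A common prime factor would make the index both 0 and 1 modulo that prime.
  have hc : (Nat.card H).Coprime H.index := by
    refine Nat.Coprime.symm (Nat.coprime_of_dvd ?_)
    intro r hr h1 h2
    have := (index_modEq_one_of_prime_dvd hH hr h2).symm.trans (Nat.modEq_zero_iff_dvd.mpr h1)
    exact hr.one_lt.ne' (Nat.dvd_one.mp (Nat.modEq_zero_iff_dvd.mp this))
  have hh1 : Nat.card H ≠ 1 := fun h => hbot (H.eq_bot_of_card_eq h)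
  have hm1 : H.index ≠ 1 := fun h => htop (Subgroup.index_eq_one.mp h)
  by_cases hpH : p ∣ Nat.card H
  · have h1 : p ^ 2 ∣ Nat.card H :=
      (Nat.Coprime.pow_left 2 (hc.coprime_dvd_left hpH)).dvd_of_dvd_mul_right (hm ▸ Dvd.intro _ rfl)
    obtain ⟨k, hk⟩ := h1
    have hkq : k * H.index = q := by
      rw [hk, mul_assoc] at hm
      exact Nat.eq_of_mul_eq_mul_left (pow_pos hp.pos 2) hm
    have hiq : H.index = q := (hq.eq_one_or_self_of_dvd _ (Dvd.intro_left _ hkq)).resolve_left hm1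
    have hk1 : k = 1 := by
      rw [hiq] at hkq
      exact Nat.eq_of_mul_eq_mul_right hq.pos (hkq.trans (one_mul q).symm)
    rw [hk1, mul_one] at hk
    have := Fact.mk hq
    -- Any subgroup of this order will do: the counting argument makes it the kernel.
    obtain ⟨K, hK⟩ := Sylow.exists_subgroup_card_pow_prime (G := Q) q (n := 1)
      (by rw [pow_one, hcard]; exact Dvd.intro_left _ rfl)
    rw [pow_one] at hK
    exact ⟨H, K, isFrobeniusPair_of_coprime hH (by rwa [hK, ← hiq]) (by rw [hk, hK, hcard]),
      .inl ⟨hk, hK⟩⟩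
  · have h1 : Nat.card H ∣ q := by
      refine Nat.Coprime.dvd_of_dvd_mul_left (k := Nat.card H) (m := p ^ 2) (n := q) ?_
        (hm ▸ Dvd.intro _ rfl)
      exact (Nat.Coprime.pow_left 2 ((Nat.Prime.coprime_iff_not_dvd hp).mpr hpH)).symm
    have hHq : Nat.card H = q := (hq.eq_one_or_self_of_dvd _ h1).resolve_left hh1
    have hi : H.index = p ^ 2 := by
      rw [hHq, mul_comm] at hm
      exact Nat.eq_of_mul_eq_mul_right hq.pos hm
    have := Fact.mk hp
    obtain ⟨K, hK⟩ := Sylow.exists_subgroup_card_pow_prime (G := Q) p (n := 2)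
      (by rw [hcard]; exact Dvd.intro _ rfl)
    refine ⟨H, K, isFrobeniusPair_of_coprime hH (by rwa [hK, ← hi])
      (by rw [hHq, hK, hcard, mul_comm]), .inr ⟨hHq, hK, ?_⟩⟩
    have := index_modEq_one_of_prime_dvd hH hq hHq.symm.dvd
    rw [hi] at this
    exact (Nat.modEq_iff_dvd' (Nat.one_le_pow _ _ hp.pos)).mp this.symm

end Frobenius

/-! ### Degrees by counting in centralizers -/

section ConjugacyClasses

variable {G : Type*} [Group G]

theorem Subgroup.mem_centralizer_singleton_iff_commute {x y : G} :
    y ∈ Subgroup.centralizer {x} ↔ Commute x y :=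
  Subgroup.mem_centralizer_singleton_iff.trans eq_comm

theorem Subgroup.mem_center_of_isConj {x y : G} (h : IsConj x y) (hy : y ∈ Subgroup.center G) :
    x ∈ Subgroup.center G := by
  obtain ⟨g, rfl⟩ := isConj_iff.mp h
  have := (Subgroup.center G).normal_of_characteristic.conj_mem _ hy g⁻¹
  simpa [mul_assoc] using this

theorem natCard_isConj_mul_natCard_centralizer (x : G) :
    Nat.card {y // IsConj x y} * Nat.card (Subgroup.centralizer {x}) = Nat.card G := by
  have h := Nat.card_congr (MulAction.orbitProdStabilizerEquivGroup (ConjAct G) x)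
  rw [Nat.card_prod] at h
  have h1 : Nat.card (MulAction.orbit (ConjAct G) x) = Nat.card {y // IsConj x y} :=
    Nat.card_congr (Equiv.subtypeEquivRight fun y => by
      rw [ConjAct.mem_orbit_conjAct, isConj_comm])
  have h2 : Nat.card (MulAction.stabilizer (ConjAct G) x) =
      Nat.card (Subgroup.centralizer {x}) :=
    Nat.card_congr (ConjAct.ofConjAct.toEquiv.subtypeEquiv fun g => by
      rw [MulAction.mem_stabilizer_iff, ConjAct.smul_def, mul_inv_eq_iff_eq_mul]
      exact Subgroup.mem_centralizer_singleton_iff.symm)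
  rw [← h1, ← h2, h]
  exact Nat.card_congr ConjAct.ofConjAct.toEquiv

/-- The conjugacy class underlying a vertex of the commuting conjugacy class graph. -/
def CCCVertex.toConjClasses (v : CCCVertex G) : ConjClasses G := v.1

theorem CCCVertex.toConjClasses_injective :
    Function.Injective (CCCVertex.toConjClasses (G := G)) :=
  fun _ _ h => Subtype.ext h

/-- The vertex of the commuting conjugacy class graph given by a non-central element. -/
def CCCVertex.mk (x : G) (hx : x ∉ Subgroup.center G) : CCCVertex G :=
  ⟨ConjClasses.mk x, x, hx, rfl⟩

theorem CCCVertex.mk_eq_of_isConj {x y : G} (hx : x ∉ Subgroup.center G)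
    (hy : y ∉ Subgroup.center G) (h : IsConj x y) : CCCVertex.mk x hx = CCCVertex.mk y hy :=
  Subtype.ext (ConjClasses.mk_eq_mk_iff_isConj.mpr h)

theorem CCCVertex.exists_eq_mk (v : CCCVertex G) : ∃ x hx, v = CCCVertex.mk x hx := by
  obtain ⟨_, x, hx, rfl⟩ := v
  exact ⟨x, hx, rfl⟩

/-- Conjugating a commuting pair simultaneously moves its first member to the prescribed `x`. -/
theorem exists_commute_of_adj_mk {x : G} {hx : x ∉ Subgroup.center G} {v : CCCVertex G}
    (h : (CCCGraph G).Adj (CCCVertex.mk x hx) v) : ∃ y, ConjClasses.mk y = v.1 ∧ Commute x y := by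
  obtain ⟨-, a, b, ha, hb, hab⟩ := h
  obtain ⟨g, hg⟩ := isConj_iff.mp (ConjClasses.mk_eq_mk_iff_isConj.mp ha)
  refine ⟨g * b * g⁻¹, ?_, ?_⟩
  · rw [← hb, ConjClasses.mk_eq_mk_iff_isConj, isConj_comm]
    exact isConj_iff.mpr ⟨g, rfl⟩
  · rw [← hg, ← MulAut.conj_apply, ← MulAut.conj_apply]
    exact Commute.map hab _

theorem CCCVertex.notMem_center {v : CCCVertex G} {y : G} (h : ConjClasses.mk y = v.1) :
    y ∉ Subgroup.center G := by
  obtain ⟨_, x, hx, rfl⟩ := v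
  exact fun hy => hx (Subgroup.mem_center_of_isConj (ConjClasses.mk_eq_mk_iff_isConj.mp h).symm hy)

theorem CCCGraph.adj_trans
    (hCA : ∀ x ∉ Subgroup.center G, ∀ a b, Commute x a → Commute x b → Commute a b)
    (u v w : CCCVertex G) (huv : (CCCGraph G).Adj u v) (hvw : (CCCGraph G).Adj v w) (huw : u ≠ w) :
    (CCCGraph G).Adj u w := by
  obtain ⟨x, hx, rfl⟩ := v.exists_eq_mk
  obtain ⟨a, ha, hxa⟩ := exists_commute_of_adj_mk huv.symm
  obtain ⟨b, hb, hxb⟩ := exists_commute_of_adj_mk hvw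
  exact ⟨huw, a, b, ha, hb, hCA x hx a b hxa hxb⟩

variable [Finite G]

open Classical in
/-- The conjugacy classes of the non-central elements commuting with `x` form the closed
neighbourhood of the class of `x`. -/
theorem exists_finset_card_degree_add_one (x : G) (hx : x ∉ Subgroup.center G) :
    ∃ (S : Finset G) (T : Finset (ConjClasses G)),
      (∀ y, y ∈ S ↔ y ∉ Subgroup.center G ∧ Commute x y) ∧ S.image ConjClasses.mk = T ∧
      S.card + Nat.card (Subgroup.center G) = Nat.card (Subgroup.centralizer {x}) ∧
      T.card = (CCCGraph G).degree (CCCVertex.mk x hx) + 1 := by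
  have := Fintype.ofFinite G
  let S : Finset G := Finset.univ.filter fun y => y ∉ Subgroup.center G ∧ Commute x y
  let v := CCCVertex.mk x hx
  have hS : ∀ y, y ∈ S ↔ y ∉ Subgroup.center G ∧ Commute x y := fun y => by simp [S]
  refine ⟨S, (insert v ((CCCGraph G).neighborFinset v)).image CCCVertex.toConjClasses, hS, ?_, ?_, ?_⟩
  · ext c
    simp only [Finset.mem_image, Finset.mem_insert, SimpleGraph.mem_neighborFinset]
    constructor
    · rintro ⟨y, hy, rfl⟩
      obtain ⟨hyZ, hxy⟩ := (hS y).mp hy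
      refine ⟨CCCVertex.mk y hyZ, ?_, rfl⟩
      by_cases h : CCCVertex.mk y hyZ = v
      · exact .inl h
      · exact .inr ⟨Ne.symm h, x, y, rfl, rfl, hxy⟩
    · rintro ⟨w, rfl | hw, rfl⟩
      · exact ⟨x, (hS x).mpr ⟨hx, Commute.refl x⟩, rfl⟩
      · obtain ⟨y, hy, hxy⟩ := exists_commute_of_adj_mk hw
        exact ⟨y, (hS y).mpr ⟨CCCVertex.notMem_center hy, hxy⟩, hy⟩
  · have h1 : Nat.card (Subgroup.center G) =
        (Finset.univ.filter fun y : G => y ∈ Subgroup.center G).card := by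
      rw [Nat.card_eq_fintype_card]
      exact Fintype.card_subtype _
    have h2 : Nat.card (Subgroup.centralizer {x}) =
        (Finset.univ.filter fun y : G => y ∈ Subgroup.centralizer {x}).card := by
      rw [Nat.card_eq_fintype_card]
      exact Fintype.card_subtype _
    rw [h1, h2, ← Finset.card_union_of_disjoint]
    · congr 1
      ext y
      simp only [S, Finset.mem_union, Finset.mem_filter, Finset.mem_univ, true_and,
        Subgroup.mem_centralizer_singleton_iff_commute]
      constructor
      · rintro (h | h)
        · exact h.2
        · exact Subgroup.mem_center_iff.mp h x
      · intro h
        by_cases hy : y ∈ Subgroup.center G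
        · exact .inr hy
        · exact .inl ⟨hy, h⟩
    · rw [Finset.disjoint_left]
      intro y hy hy'
      simp only [S, Finset.mem_filter, Finset.mem_univ, true_and] at hy hy'
      exact hy.1 hy'
  · rw [Finset.card_image_of_injective _ CCCVertex.toConjClasses_injective,
      Finset.card_insert_of_notMem (by simp), SimpleGraph.card_neighborFinset_eq_degree]

open Classical in
theorem card_filter_mk_eq {x y : G} {S : Finset G} (hy : y ∉ Subgroup.center G)
    (hS : ∀ y, y ∈ S ↔ y ∉ Subgroup.center G ∧ Commute x y) :
    (S.filter fun a => ConjClasses.mk a = ConjClasses.mk y).card =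
      Nat.card {a // Commute x a ∧ IsConj y a} := by
  have := Fintype.ofFinite G
  rw [Nat.card_eq_fintype_card, Fintype.card_subtype]
  congr 1
  ext a
  simp only [Finset.mem_filter, hS, Finset.mem_univ, true_and, ConjClasses.mk_eq_mk_iff_isConj,
    isConj_comm (g := a) (h := y)]
  exact ⟨fun h => ⟨h.1.2, h.2⟩,
    fun h => ⟨⟨fun ha => hy (Subgroup.mem_center_of_isConj h.2 ha), h.1⟩, h.2⟩⟩

/-- The non-central part of the centralizer of `x` is partitioned by the degree + 1 classes that
meet it, and `f` bounds the size of each piece. -/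
theorem mul_degree_add_one_le {x : G} (hx : x ∉ Subgroup.center G) (f : ℕ)
    (hf : ∀ y ∉ Subgroup.center G, Commute x y → f ≤ Nat.card {a // Commute x a ∧ IsConj y a}) :
    f * ((CCCGraph G).degree (CCCVertex.mk x hx) + 1) + Nat.card (Subgroup.center G) ≤
      Nat.card (Subgroup.centralizer {x}) := by
  classical
  obtain ⟨S, T, hS, hST, hcS, hcT⟩ := exists_finset_card_degree_add_one x hx
  rw [← hcS, ← hcT, mul_comm, ← hST, mul_comm]
  gcongr
  refine Finset.mul_card_image_le_card S f ?_
  intro c hc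
  obtain ⟨y, hy, rfl⟩ := Finset.mem_image.mp hc
  have := (hS y).mp hy
  rw [card_filter_mk_eq this.1 hS]
  exact hf y this.1 this.2

theorem le_mul_degree_add_one {x : G} (hx : x ∉ Subgroup.center G) (f : ℕ)
    (hf : ∀ y ∉ Subgroup.center G, Commute x y → Nat.card {a // Commute x a ∧ IsConj y a} ≤ f) :
    Nat.card (Subgroup.centralizer {x}) ≤
      f * ((CCCGraph G).degree (CCCVertex.mk x hx) + 1) + Nat.card (Subgroup.center G) := by
  classical
  obtain ⟨S, T, hS, hST, hcS, hcT⟩ := exists_finset_card_degree_add_one x hx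
  rw [← hcS, ← hcT, mul_comm, ← hST, mul_comm]
  gcongr
  refine Finset.card_le_mul_card_image S f ?_
  intro c hc
  obtain ⟨y, hy, rfl⟩ := Finset.mem_image.mp hc
  have := (hS y).mp hy
  rw [card_filter_mk_eq this.1 hS]
  exact hf y this.1 this.2

theorem mul_degree_add_one_eq {x : G} (hx : x ∉ Subgroup.center G) (f : ℕ)
    (hf : ∀ y ∉ Subgroup.center G, Commute x y → Nat.card {a // Commute x a ∧ IsConj y a} = f) :
    f * ((CCCGraph G).degree (CCCVertex.mk x hx) + 1) + Nat.card (Subgroup.center G) =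
      Nat.card (Subgroup.centralizer {x}) :=
  (mul_degree_add_one_le hx f fun y hy h => (hf y hy h).ge).antisymm
    (le_mul_degree_add_one hx f fun y hy h => (hf y hy h).le)

end ConjugacyClasses

/-! ### Lifting the Frobenius structure from the central quotient -/

section CentralQuotient

variable {G : Type*} [Group G]

local notation "Z" => Subgroup.center G

local notation "π" => QuotientGroup.mk' (Subgroup.center G)

theorem mk_center_ne_one {x : G} (hx : x ∉ Z) : π x ≠ 1 :=
  fun h => hx ((QuotientGroup.eq_one_iff x).mp h)

theorem exists_mul_of_mk_center_eq {a b : G} (h : π a = π b) : ∃ c ∈ Z, a * c = b :=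
  ⟨a⁻¹ * b, QuotientGroup.eq.mp h, by group⟩

theorem commute_mul_of_mem_center {a b c : G} (hc : c ∈ Z) (h : Commute a b) :
    Commute a (b * c) :=
  h.mul_right (Subgroup.mem_center_iff.mp hc a)

theorem commute_of_mk_center_eq {a b c : G} (h : π b = π c) (hab : Commute a b) : Commute a c := by
  obtain ⟨z, hz, rfl⟩ := exists_mul_of_mk_center_eq h
  exact commute_mul_of_mem_center hz hab

/-- The preimage of `L` is generated by the centre and a single element. -/
theorem commute_of_isCyclic {L : Subgroup (G ⧸ Z)} [IsCyclic L] {a b : G} (ha : π a ∈ L)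
    (hb : π b ∈ L) : Commute a b := by
  obtain ⟨⟨t, ht⟩, hgen⟩ := IsCyclic.exists_generator (α := L)
  obtain ⟨g, rfl⟩ := QuotientGroup.mk'_surjective Z t
  obtain ⟨i, hi⟩ := Subgroup.mem_zpowers_iff.mp (hgen ⟨π a, ha⟩)
  obtain ⟨j, hj⟩ := Subgroup.mem_zpowers_iff.mp (hgen ⟨π b, hb⟩)
  have hi' : π (g ^ i) = π a := by rw [map_zpow]; exact congrArg Subtype.val hi
  have hj' : π (g ^ j) = π b := by rw [map_zpow]; exact congrArg Subtype.val hj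
  have h1 : Commute (g ^ i) (g ^ j) := Commute.zpow_zpow (Commute.refl g) i j
  exact (commute_of_mk_center_eq hi' (commute_of_mk_center_eq hj' h1).symm).symm

theorem mem_map_centralizer_iff {x y : G} :
    π y ∈ (Subgroup.centralizer {x}).map π ↔ Commute x y := by
  constructor
  · rintro ⟨w, hw, he⟩
    exact commute_of_mk_center_eq he (Subgroup.mem_centralizer_singleton_iff_commute.mp hw)
  · exact fun h => ⟨y, Subgroup.mem_centralizer_singleton_iff_commute.mpr h, rfl⟩

theorem centralizer_eq_comap {x : G} {L : Subgroup (G ⧸ Z)} (h : ∀ y, Commute x y ↔ π y ∈ L) :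
    Subgroup.centralizer {x} = L.comap π := by
  ext y
  rw [Subgroup.mem_centralizer_singleton_iff_commute, h, Subgroup.mem_comap]

theorem map_commute {x y : G} (h : Commute x y) : Commute (π x) (π y) := h.map π

theorem exists_notMem_center_of_ne_bot {L : Subgroup (G ⧸ Z)} (hL : L ≠ ⊥) :
    ∃ x : G, x ∉ Z ∧ π x ∈ L := by
  obtain ⟨t, ht, h1⟩ := L.ne_bot_iff_exists_ne_one.mp hL |>.elim fun t h =>
    (⟨t.1, t.2, fun h' => h (Subtype.ext h')⟩ : ∃ t ∈ L, t ≠ 1)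
  obtain ⟨x, rfl⟩ := QuotientGroup.mk'_surjective Z t
  exact ⟨x, fun h => h1 ((QuotientGroup.eq_one_iff x).mpr h), ht⟩

variable {H K : Subgroup (G ⧸ Subgroup.center G)} (hF : IsFrobeniusPair H K)
include hF

theorem IsFrobeniusPair.centralizer_eq_comap_complement [IsCyclic H] {x : G} (hx : x ∉ Z)
    (hxH : π x ∈ H) : Subgroup.centralizer {x} = H.comap π :=
  centralizer_eq_comap fun _ =>
    ⟨fun h => hF.mem_of_commute_left hxH (mk_center_ne_one hx) (map_commute h),
      fun h => commute_of_isCyclic hxH h⟩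

theorem IsFrobeniusPair.centralizer_eq_comap_kernel
    (hK : ∀ a b : G, π a ∈ K → π b ∈ K → Commute a b) {x : G} (hx : x ∉ Z)
    (hxK : π x ∈ K) : Subgroup.centralizer {x} = K.comap π :=
  centralizer_eq_comap fun y =>
    ⟨fun h => hF.mem_of_commute _ hxK (mk_center_ne_one hx) _ (map_commute h), hK x y hxK⟩

theorem IsFrobeniusPair.commute_of_commute [IsCyclic H]
    (hK : ∀ x ∉ Z, π x ∈ K → ∀ a b, Commute x a → Commute x b → Commute a b)
    (x : G) (hx : x ∉ Z) (a b : G) (ha : Commute x a) (hb : Commute x b) : Commute a b := by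
  rcases hF.mem_or_conj_mem (π x) with hxK | ⟨g, hg⟩
  · exact hK x hx hxK a b ha hb
  · obtain ⟨g, rfl⟩ := QuotientGroup.mk'_surjective Z g
    have hx' : g * x * g⁻¹ ∉ Z := fun h =>
      hx (Subgroup.mem_center_of_isConj (isConj_iff.mpr ⟨g, rfl⟩) h)
    have key : ∀ c, Commute x c → π (g * c * g⁻¹) ∈ H := fun c hc => by
      refine hF.mem_of_commute_left (x := π (g * x * g⁻¹)) (by simpa using hg)
        (mk_center_ne_one hx') (map_commute ?_)
      simpa using hc.map (MulAut.conj g)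
    have := commute_of_isCyclic (key a ha) (key b hb)
    have := this.map (MulAut.conj g⁻¹)
    simpa [mul_assoc] using this

/-- Every vertex comes from an element lying over the complement or over the kernel. -/
theorem IsFrobeniusPair.exists_eq_mk (v : CCCVertex G) :
    ∃ x hx, v = CCCVertex.mk x hx ∧ (π x ∈ K ∨ π x ∈ H) := by
  obtain ⟨x, hx, rfl⟩ := v.exists_eq_mk
  rcases hF.mem_or_conj_mem (π x) with hxK | ⟨g, hg⟩
  · exact ⟨x, hx, rfl, .inl hxK⟩
  · obtain ⟨g, rfl⟩ := QuotientGroup.mk'_surjective Z g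
    have hconj : IsConj x (g * x * g⁻¹) := isConj_iff.mpr ⟨g, rfl⟩
    exact ⟨g * x * g⁻¹, fun h => hx (Subgroup.mem_center_of_isConj hconj h),
      CCCVertex.mk_eq_of_isConj _ _ hconj, .inr (by simpa using hg)⟩

variable [Finite G]

omit hF in
theorem natCard_comap_mk_center (L : Subgroup (G ⧸ Z)) :
    Nat.card (L.comap π) = Nat.card L * Nat.card Z := by
  have h1 := (L.comap π).card_mul_index
  rw [L.index_comap_of_surjective (QuotientGroup.mk'_surjective Z),
    Subgroup.card_eq_card_quotient_mul_card_subgroup Z, ← L.card_mul_index] at h1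
  refine Nat.eq_of_mul_eq_mul_right (Nat.pos_of_ne_zero L.index_ne_zero_of_finite) ?_
  rw [h1]; ring

theorem IsFrobeniusPair.degree_complement [IsCyclic H] {x : G} (hx : x ∉ Z) (hxH : π x ∈ H) :
    (CCCGraph G).degree (CCCVertex.mk x hx) + 1 + Nat.card Z = Nat.card H * Nat.card Z := by
  rw [← natCard_comap_mk_center, ← hF.centralizer_eq_comap_complement hx hxH,
    ← mul_degree_add_one_eq hx 1, one_mul]
  -- A conjugate of `y` over `H` must be `y` itself: the conjugating element also lies over `H`,
  -- whose preimage is abelian.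
  intro y hy hxy
  have hyH := hF.mem_of_commute_left hxH (mk_center_ne_one hx) (map_commute hxy)
  rw [Nat.card_eq_one_iff_unique]
  refine ⟨⟨?_⟩, ⟨⟨y, hxy, IsConj.refl y⟩⟩⟩
  suffices ∀ a, Commute x a ∧ IsConj y a → a = y from
    fun ⟨a, ha⟩ ⟨b, hb⟩ => Subtype.ext ((this a ha).trans (this b hb).symm)
  rintro a ⟨hxa, hya⟩
  obtain ⟨g, rfl⟩ := isConj_iff.mp hya
  have haH := hF.mem_of_commute_left hxH (mk_center_ne_one hx) (map_commute hxa)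
  rw [map_mul, map_mul, map_inv] at haH
  have hg := hF.mem_of_conj_mem _ hyH (mk_center_ne_one hy) _ haH
  rw [(commute_of_isCyclic hg hyH : Commute g y).eq, mul_inv_cancel_right]

theorem IsFrobeniusPair.degree_kernel (hHK : Nat.card H * Nat.card K = Nat.card (G ⧸ Z))
    (hK : ∀ a b : G, π a ∈ K → π b ∈ K → Commute a b) {x : G} (hx : x ∉ Z) (hxK : π x ∈ K) :
    Nat.card H * ((CCCGraph G).degree (CCCVertex.mk x hx) + 1) + Nat.card Z =
      Nat.card K * Nat.card Z := by
  rw [← natCard_comap_mk_center, ← hF.centralizer_eq_comap_kernel hK hx hxK,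
    ← mul_degree_add_one_eq hx (Nat.card H)]
  intro y hy hxy
  have hyK := hF.mem_of_commute _ hxK (mk_center_ne_one hx) _ (map_commute hxy)
  -- The class of `y` has size |H|, since its centralizer is the preimage of `K`; by normality it
  -- lies wholly in that preimage, which centralizes `x`.
  have h1 := natCard_isConj_mul_natCard_centralizer y
  rw [hF.centralizer_eq_comap_kernel hK hy hyK, natCard_comap_mk_center,
    Subgroup.card_eq_card_quotient_mul_card_subgroup Z, ← hHK, mul_assoc] at h1
  have h2 : Nat.card {a // IsConj y a} = Nat.card H :=
    Nat.eq_of_mul_eq_mul_right (Nat.mul_pos Nat.card_pos Nat.card_pos) h1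
  rw [← h2]
  refine Nat.card_congr (Equiv.subtypeEquivRight fun a => ⟨And.right, fun h => ⟨?_, h⟩⟩)
  obtain ⟨g, rfl⟩ := isConj_iff.mp h
  refine hK _ _ hxK ?_
  rw [map_mul, map_mul, map_inv]
  exact hF.normal.conj_mem _ hyK _

/-! ### Kernels of order p², with possibly non-abelian preimage -/

section PrimeSq

variable {p : ℕ} (hp : p.Prime) (hKp : Nat.card K = p ^ 2)
include hp hKp

theorem IsFrobeniusPair.natCard_map_centralizer {x : G} (hx : x ∉ Z) (hxK : π x ∈ K)
    (hnc : ∃ y, π y ∈ K ∧ ¬ Commute x y) :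
    Nat.card ((Subgroup.centralizer {x}).map π) = p := by
  obtain ⟨y, hyK, hxy⟩ := hnc
  have hle : (Subgroup.centralizer {x}).map π ≤ K := by
    rintro _ ⟨w, hw, rfl⟩
    exact hF.mem_of_commute _ hxK (mk_center_ne_one hx) _
      (map_commute (Subgroup.mem_centralizer_singleton_iff_commute.mp hw))
  have hdvd := Subgroup.card_dvd_of_le hle
  rw [hKp, Nat.dvd_prime_pow hp] at hdvd
  obtain ⟨k, hk, hcard⟩ := hdvd
  interval_cases k
  · rw [pow_zero] at hcard
    have hbot := Subgroup.eq_bot_of_card_eq _ hcard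
    have hmem := mem_map_centralizer_iff.mpr (Commute.refl x)
    rw [hbot, Subgroup.mem_bot] at hmem
    exact absurd hmem (mk_center_ne_one hx)
  · rwa [pow_one] at hcard
  · have heq := Subgroup.eq_of_le_of_card_ge hle (by rw [hcard, hKp])
    rw [← heq] at hyK
    exact absurd (mem_map_centralizer_iff.mp hyK) hxy

/-- If `a` and `b` failed to commute, the image of the centralizer of `b` would have prime order and
be generated by the image of `x`. Then `b` would be a power of `x` times a central element, and so
commute with `a`. -/
theorem IsFrobeniusPair.commute_of_forall_commute {x : G} (hx : x ∉ Z)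
    (h : ∀ y, π y ∈ K → Commute x y) {a b : G} (ha : π a ∈ K) (hb : π b ∈ K) : Commute a b := by
  by_contra hab
  have hZ : ∀ {a b : G}, ¬ Commute a b → a ∉ Z := fun hab ha =>
    hab (Subgroup.mem_center_iff.mp ha _).symm
  have hba : ¬ Commute b a := fun h => hab h.symm
  have := Fact.mk hp
  have hcb := hF.natCard_map_centralizer hp hKp (hZ hba) hb ⟨a, ha, hba⟩
  have hxb : π x ∈ (Subgroup.centralizer {b}).map π := mem_map_centralizer_iff.mpr (h b hb).symm
  have hbb : π b ∈ (Subgroup.centralizer {b}).map π := mem_map_centralizer_iff.mpr (Commute.refl b)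
  obtain ⟨n, hn⟩ := mem_zpowers_of_prime_card hcb (g := ⟨π x, hxb⟩) (g' := ⟨π b, hbb⟩)
    (fun h => mk_center_ne_one hx (congrArg Subtype.val h))
  have hn' : π (x ^ n) = π b := by rw [map_zpow]; exact congrArg Subtype.val hn
  exact hab (commute_of_mk_center_eq hn' ((h a ha).symm.zpow_right n))

theorem IsFrobeniusPair.commute_of_commute_kernel (x : G) (hx : x ∉ Z) (hxK : π x ∈ K) (a b : G)
    (ha : Commute x a) (hb : Commute x b) : Commute a b := by
  have hmem : ∀ c, Commute x c → π c ∈ K := fun c hc =>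
    hF.mem_of_commute _ hxK (mk_center_ne_one hx) _ (map_commute hc)
  by_cases h : ∀ y, π y ∈ K → Commute x y
  · exact hF.commute_of_forall_commute hp hKp hx h (hmem a ha) (hmem b hb)
  · push Not at h
    have := Fact.mk hp
    have := isCyclic_of_prime_card (hF.natCard_map_centralizer hp hKp hx hxK h)
    exact commute_of_isCyclic (mem_map_centralizer_iff.mpr ha) (mem_map_centralizer_iff.mpr hb)

/-- Every non-central `y` over `K` now has centralizer of order p·z, so its class within the
preimage of `K` has at least p elements. As `K` is abelian, these all lie in the coset of `y` modulo
the centre, hence in the centralizer of `x`. -/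
theorem IsFrobeniusPair.degree_kernel_le (hK : ∃ a b : G, π a ∈ K ∧ π b ∈ K ∧ ¬ Commute a b)
    {x : G} (hx : x ∉ Z) (hxK : π x ∈ K) :
    p * ((CCCGraph G).degree (CCCVertex.mk x hx) + 1) + Nat.card Z ≤ p * Nat.card Z := by
  have hcard : ∀ {y : G}, y ∉ Z → π y ∈ K → Nat.card (Subgroup.centralizer {y}) =
      p * Nat.card Z := fun {y} hy hyK => by
    rw [centralizer_eq_comap (L := (Subgroup.centralizer {y}).map π)
      (fun w => mem_map_centralizer_iff.symm), natCard_comap_mk_center,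
      hF.natCard_map_centralizer hp hKp hy hyK]
    obtain ⟨a, b, ha, hb, hab⟩ := hK
    by_contra! h
    exact hab (hF.commute_of_forall_commute hp hKp hy h ha hb)
  rw [← hcard hx hxK]
  refine mul_degree_add_one_le hx p fun y hy hxy => ?_
  have hyK := hF.mem_of_commute _ hxK (mk_center_ne_one hx) _ (map_commute hxy)
  let y' : K.comap π := ⟨y, hyK⟩
  have h1 := natCard_isConj_mul_natCard_centralizer y'
  rw [natCard_comap_mk_center, hKp] at h1
  have h2 : Nat.card (Subgroup.centralizer {y'}) ≤ p * Nat.card Z := by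
    rw [← hcard hy hyK]
    refine Nat.card_le_card_of_injective (fun w => ⟨w.1.1, ?_⟩) ?_
    · have := Subgroup.mem_centralizer_singleton_iff_commute.mp w.2
      exact Subgroup.mem_centralizer_singleton_iff_commute.mpr
        (this.map (K.comap π).subtype)
    · exact fun w w' h => Subtype.ext (Subtype.ext (Subtype.mk.inj h))
  have h3 : p ≤ Nat.card {a // IsConj y' a} := by
    have hpos : 0 < p * Nat.card Z := Nat.mul_pos hp.pos Nat.card_pos
    refine Nat.le_of_mul_le_mul_right (c := p * Nat.card Z) ?_ hpos
    calc p * (p * Nat.card Z) = p ^ 2 * Nat.card Z := by ring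
      _ ≤ _ := by rw [← h1]; gcongr
  refine h3.trans (Nat.card_le_card_of_injective (fun w => ⟨w.1.1, ?_⟩) ?_)
  · obtain ⟨⟨w, hwK⟩, hw⟩ := w
    obtain ⟨⟨g, hgK⟩, hg⟩ := isConj_iff.mp hw
    have hg' : g * y * g⁻¹ = w := congrArg Subtype.val hg
    refine ⟨?_, isConj_iff.mpr ⟨g, hg'⟩⟩
    have := Fact.mk hp
    have hcomm : π g * π y = π y * π g := congrArg Subtype.val <|
      (IsPGroup.isMulCommutative_of_card_eq_prime_sq hKp).is_comm.comm ⟨π g, hgK⟩ ⟨π y, hyK⟩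
    refine commute_of_mk_center_eq (b := y) ?_ hxy
    change π y = π w
    rw [← hg', map_mul, map_mul, map_inv,
      hcomm, mul_inv_cancel_right]
  · exact fun w w' h => Subtype.ext (Subtype.ext (Subtype.mk.inj h))

end PrimeSq

end CentralQuotient

/-! ### Cyclic complements and arithmetic of p and q -/

theorem IsFrobeniusPair.isCyclic_complement {Q : Type*} [Group Q] [Finite Q] {H K : Subgroup Q}
    (hF : IsFrobeniusPair H K) {q : ℕ} (hq : q.Prime) (hK : Nat.card K = q) : IsCyclic H := by
  have := Fact.mk hq
  have := hF.normal
  have hcyc : IsCyclic K := isCyclic_of_prime_card hK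
  have : IsCyclic (ZMod (Nat.card K))ˣ := by rw [hK]; infer_instance
  -- Conjugation embeds `H` in the automorphism group of `K`, which is cyclic because |K| is prime;
  -- faithfulness holds as nontrivial elements of `K` commute only with elements of `K`.
  refine isCyclic_of_injective ((IsCyclic.mulAutMulEquiv K).toMonoidHom.comp
    ((MulAut.conjNormal (H := K)).comp H.subtype)) ?_
  rw [MonoidHom.coe_comp]
  refine (IsCyclic.mulAutMulEquiv K).injective.comp ?_
  rw [injective_iff_map_eq_one]
  rintro ⟨h, hh⟩ he
  have hbot : K ≠ ⊥ := by
    rintro rfl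
    rw [Subgroup.card_bot] at hK
    exact hq.one_lt.ne hK
  obtain ⟨⟨k, hk⟩, hk1⟩ := K.ne_bot_iff_exists_ne_one.mp hbot
  have hkh : h * k * h⁻¹ = k := by
    have := congrArg (fun f : MulAut K => (f ⟨k, hk⟩ : Q)) he
    simpa using this
  have hcomm : Commute k h := (mul_inv_eq_iff_eq_mul.mp hkh).symm
  have hhK := hF.mem_of_commute k hk (fun h => hk1 (Subtype.ext h)) h hcomm
  exact Subtype.ext (Subgroup.disjoint_def.mp hF.disjoint hh hhK)

theorem eq_two_and_eq_three_of_dvd_sq_sub_one {p q : ℕ} (hp : p.Prime) (hq : q.Prime)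
    (hpq : p < q) (h : q ∣ p ^ 2 - 1) : p = 2 ∧ q = 3 := by
  have h1 : p ^ 2 - 1 = (p + 1) * (p - 1) := by simpa using Nat.sq_sub_sq p 1
  rw [h1] at h
  have hp2 := hp.two_le
  have hqp : q = p + 1 := by
    rcases (Nat.Prime.dvd_mul hq).mp h with h | h
    · have := Nat.le_of_dvd (by omega) h
      omega
    · have := Nat.le_of_dvd (by omega) h
      omega
  rcases hp.eq_two_or_odd' with h2 | h2
  · omega
  · have := hq.eq_two_or_odd'
    rcases this with h3 | h3
    · omega
    · obtain ⟨a, ha⟩ := h2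
      obtain ⟨b, hb⟩ := h3
      omega

theorem eq_two_and_eq_three_of_sq_mul_eq_twelve {p q : ℕ} (hp : p.Prime) (hq : q.Prime)
    (h : p ^ 2 * q = 12) : p = 2 ∧ q = 3 := by
  have hp2 := hp.two_le
  have hq2 := hq.two_le
  have : p ≤ 2 := by
    by_contra! h3
    nlinarith [Nat.pow_le_pow_left h3 2]
  have hp' : p = 2 := by omega
  subst hp'
  exact ⟨rfl, by omega⟩

/-! ### Comparing the degrees over the complement and the kernel -/

theorem exists_degree_ne_iff_of_kernel_prime {G : Type*} [Group G] [Finite G]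
    {H K : Subgroup (G ⧸ Subgroup.center G)} (hF : IsFrobeniusPair H K) {p q : ℕ}
    (hp : p.Prime) (hq : q.Prime) (hcard : Nat.card (G ⧸ Subgroup.center G) = p ^ 2 * q)
    (hH : Nat.card H = p ^ 2) (hK : Nat.card K = q) [IsCyclic H] [IsCyclic K] :
    (∃ v, 0 < (CCCGraph G).degree v) ∧
      ((∃ u v, (CCCGraph G).degree u ≠ (CCCGraph G).degree v) ↔ q + p ^ 2 ≠ p ^ 4 + 1) := by
  have hz : 0 < Nat.card (Subgroup.center G) := Nat.card_pos
  have hp4 : 4 ≤ p ^ 2 := Nat.pow_le_pow_left hp.two_le 2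
  have hdH := fun (x : G) hx => hF.degree_complement (x := x) hx
  have hdK := fun (x : G) hx => hF.degree_kernel (by rw [hH, hK, hcard])
    (fun a b => commute_of_isCyclic) (x := x) hx
  simp only [hH, hK] at hdH hdK
  obtain ⟨x, hx, hxH⟩ := exists_notMem_center_of_ne_bot (L := H) (by
    rintro rfl
    rw [Subgroup.card_bot] at hH
    omega)
  obtain ⟨y, hy, hyK⟩ := exists_notMem_center_of_ne_bot (L := K) (by
    rintro rfl
    rw [Subgroup.card_bot] at hK
    exact hq.one_lt.ne hK)
  generalize Nat.card (Subgroup.center G) = z at *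
  have hx' := hdH x hx hxH
  have hy' := hdK y hy hyK
  refine ⟨⟨CCCVertex.mk x hx, by nlinarith⟩, ?_, ?_⟩
  · rintro ⟨u, v, huv⟩ heq
    -- Under the exceptional equation the kernel formula turns into the complement formula, so the
    -- graph is regular.
    have key : ∀ v, (CCCGraph G).degree v + 1 + z = p ^ 2 * z := fun v => by
      obtain ⟨w, hw, rfl, hwK | hwH⟩ := hF.exists_eq_mk v
      · have := hdK w hw hwK
        refine Nat.eq_of_mul_eq_mul_left (show 0 < p ^ 2 by omega) ?_
        zify at *
        linear_combination this + z * heq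
      · exact hdH w hw hwH
    have h1 := key u
    have h2 := key v
    omega
  · intro hne
    refine ⟨CCCVertex.mk x hx, CCCVertex.mk y hy, fun h => hne ?_⟩
    rw [← h] at hy'
    refine Nat.eq_of_mul_eq_mul_right hz ?_
    zify at *
    linear_combination p ^ 2 * hx' - hy'

theorem exists_degree_ne_of_kernel_prime_sq {G : Type*} [Group G] [Finite G]
    {H K : Subgroup (G ⧸ Subgroup.center G)} (hF : IsFrobeniusPair H K) {p q : ℕ}
    (hp : p.Prime) (hq : q.Prime) (hcard : Nat.card (G ⧸ Subgroup.center G) = p ^ 2 * q)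
    (hH : Nat.card H = q) (hK : Nat.card K = p ^ 2) [IsCyclic H]
    (hpq : q < p ∨ (p = 2 ∧ q = 3)) :
    (∃ v, 0 < (CCCGraph G).degree v) ∧
      ∃ u v, (CCCGraph G).degree u ≠ (CCCGraph G).degree v := by
  have hz : 0 < Nat.card (Subgroup.center G) := Nat.card_pos
  have hq2 := hq.two_le
  have hp2 := hp.two_le
  obtain ⟨x, hx, hxH⟩ := exists_notMem_center_of_ne_bot (L := H) (by
    rintro rfl
    rw [Subgroup.card_bot] at hH
    omega)
  obtain ⟨y, hy, hyK⟩ := exists_notMem_center_of_ne_bot (L := K) (by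
    rintro rfl
    rw [Subgroup.card_bot] at hK
    nlinarith)
  have hx' := hF.degree_complement hx hxH
  rw [hH] at hx'
  by_cases hab : ∀ a b : G, QuotientGroup.mk' (Subgroup.center G) a ∈ K →
      QuotientGroup.mk' (Subgroup.center G) b ∈ K → Commute a b
  · have hy' := hF.degree_kernel (by rw [hH, hK, hcard, mul_comm]) hab hy hyK
    rw [hH, hK] at hy'
    generalize Nat.card (Subgroup.center G) = z at *
    refine ⟨?_, CCCVertex.mk x hx, CCCVertex.mk y hy, fun h => ?_⟩
    · rcases hq2.eq_or_lt with rfl | hq3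
      · have hp3 : 3 ≤ p := by omega
        refine ⟨CCCVertex.mk y hy, ?_⟩
        have := Nat.mul_le_mul_right z (Nat.pow_le_pow_left hp3 2)
        omega
      · refine ⟨CCCVertex.mk x hx, ?_⟩
        have := Nat.mul_le_mul_right z (show 3 ≤ q from hq3)
        omega
    · rw [← h] at hy'
      have h1 : (q ^ 2 + 1) * z = (p ^ 2 + q) * z := by
        zify at *
        linear_combination hy' - q * hx'
      have h2 := Nat.eq_of_mul_eq_mul_right hz h1
      rcases hpq with hlt | ⟨rfl, rfl⟩
      · nlinarith
      · omega
  · push Not at hab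
    have hy' := hF.degree_kernel_le hp hK hab hy hyK
    generalize Nat.card (Subgroup.center G) = z at *
    have hxz := Nat.mul_le_mul_right z hq2
    refine ⟨⟨CCCVertex.mk x hx, ?_⟩, CCCVertex.mk x hx, CCCVertex.mk y hy, fun h => ?_⟩
    -- Degree 0 over `H` forces z = 1, and then the bound over `K` reads p·(degree + 1) + 1 ≤ p.
    · by_contra! h0
      have : z = 1 := by omega
      subst this
      nlinarith
    · rw [← h] at hy'
      nlinarith

/-- The exceptional equation q = p⁴ - p² + 1 is written additively to avoid truncated subtraction.
It fails for q < p and for (p, q) = (2, 3), which gives the final clause on strictness. -/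
theorem mainTheorem6 {G : Type*} [Group G] [Finite G] (p q : ℕ)
    (hp : p.Prime) (hq : q.Prime)
    (hFrob : IsFrobeniusGroup (G ⧸ Subgroup.center G))
    (hcard : Nat.card (G ⧸ Subgroup.center G) = p ^ 2 * q)
    (hcase : Nonempty ((G ⧸ Subgroup.center G) ≃* alternatingGroup (Fin 4)) ∨
      (p < q ∧ Nat.card (G ⧸ Subgroup.center G) ≠ 12) ∨ q < p) :
    (CCCGraph G).SatisfiesHansenVukicevic ∧
      ((CCCGraph G).secondZagrebRatio > (CCCGraph G).firstZagrebRatio ↔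
        q + p ^ 2 ≠ p ^ 4 + 1) := by
  obtain ⟨H, K, hF, ⟨hH, hK⟩ | ⟨hH, hK, hdvd⟩⟩ := hFrob.exists_isFrobeniusPair hp hq hcard
  · have := Fact.mk hq
    have hKc : IsCyclic K := isCyclic_of_prime_card hK
    have hHc := hF.isCyclic_complement hq hK
    have hCA := hF.commute_of_commute fun x hx hxK a b ha hb =>
      commute_of_isCyclic (hF.mem_of_commute _ hxK (mk_center_ne_one hx) _ (map_commute ha))
        (hF.mem_of_commute _ hxK (mk_center_ne_one hx) _ (map_commute hb))
    obtain ⟨hpos, hiff⟩ := exists_degree_ne_iff_of_kernel_prime hF hp hq hcard hH hK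
    rw [← hiff]
    exact SimpleGraph.satisfiesHansenVukicevic_of_adj_degree_eq
      (fun _ _ => SimpleGraph.degree_eq_of_adj_of_trans (CCCGraph.adj_trans hCA)) hpos
  · have := Fact.mk hq
    have hHc : IsCyclic H := isCyclic_of_prime_card hH
    have hpq : q < p ∨ (p = 2 ∧ q = 3) := by
      rcases hcase with ⟨⟨e⟩⟩ | ⟨hlt, h12⟩ | hlt
      · refine .inr (eq_two_and_eq_three_of_sq_mul_eq_twelve hp hq ?_)
        rw [← hcard, Nat.card_congr e.toEquiv, nat_card_alternatingGroup, Nat.card_fin]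
        rfl
      · exact .inr (eq_two_and_eq_three_of_dvd_sq_sub_one hp hq hlt hdvd)
      · exact .inl hlt
    have hCA := hF.commute_of_commute (hF.commute_of_commute_kernel hp hK)
    obtain ⟨hpos, hne⟩ := exists_degree_ne_of_kernel_prime_sq hF hp hq hcard hH hK hpq
    -- From q ≤ p² - 1 the left side is below 2p², hence below p⁴.
    have hle : q + p ^ 2 ≠ p ^ 4 + 1 := by
      have h4 : 4 ≤ p ^ 2 := Nat.pow_le_pow_left hp.two_le 2
      have := Nat.le_of_dvd (by omega) hdvd
      have hsq : p ^ 4 = p ^ 2 * p ^ 2 := by ring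
      nlinarith [Nat.sub_add_cancel (show 1 ≤ p ^ 2 by omega)]
    obtain ⟨hHV, hiff⟩ := SimpleGraph.satisfiesHansenVukicevic_of_adj_degree_eq
      (fun _ _ => SimpleGraph.degree_eq_of_adj_of_trans (CCCGraph.adj_trans hCA)) hpos
    exact ⟨hHV, iff_of_true (hiff.mpr hne) hle⟩
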